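/- Let $M$ be a connected Hausdorff smooth manifold (finite-dimensional, without boundary) equipped with a continuous Riemannian metric $g$, i.e. a positive definite symmetric $(0,2)$-tensor field depending continuously on the point, and write $\|v\|_g=\sqrt{g(v,v)}$. Let $d$ be the distance induced by $g$, $$d(p,q)=\inf\Big\{\int_0^1\|\sigma'(t)\|_g\,dt \;:\; \sigma\colon[0,1]\to M \text{ piecewise smooth},\ \sigma(0)=p,\ \sigma(1)=q\Big\}.$$ Let $a<b$ and let $\gamma\colon[a,b]\to M$ be an absolutely continuous path, i.e. $\gamma$ is continuous and for every chart $u\colon U\to\mathbb{R}^n$ of $M$ the map $u\circ\gamma$ is locally absolutely continuous on $\gamma^{-1}(U)$ (absolutely continuous on every closed interval $[c,e]\subseteq[a,b]$ with $\gamma([c,e])\subseteq U$). Then the derivative $\gamma'(t)$ exists for almost every $t\in[a,b]$ and $\|\gamma'\|_g$ is integrable on $[a,b]$; the metric derivative $$|\dot\gamma|(t)=\lim_{\delta\to0}\frac{d(\gamma(t+\delta),\gamma(t))}{|\delta|}$$ exists for almost every $t\in[a,b]$ and is integrable; the polygonal sums $\sum_{i=1}^k d(\gamma(t_{i-1}),\gamma(t_i))$,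 $a=t_0<\dots<t_k=b$, are bounded above; and the Riemannian arc-length, the induced length and the metric arc-length of $\gamma$ agree: $$\int_a^b\|\gamma'(t)\|_g\,dt \;=\; \sup\Big\{\sum_{i=1}^k d(\gamma(t_{i-1}),\gamma(t_i)) \;:\; k\in\mathbb{N},\ a=t_0<\dots<t_k=b\Big\} \;=\; \int_a^b|\dot\gamma|(t)\,dt .$$ -/

import Mathlib

open Set Filter MeasureTheory
open scoped Manifold ContDiff Topology

noncomputable section

namespace ContRiem

/-- A continuous Riemannian metric on an `n`-dimensional smooth manifold `M`: a positive definite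
symmetric bilinear form `g.inner x` on each tangent space, depending continuously on the point `x`.
(The field `isVonNBounded` of the Mathlib structure, which says that the unit balls of `g` are
bounded, holds automatically because the tangent spaces are finite-dimensional.) -/
abbrev RMetric (n : ℕ) (M : Type*) [TopologicalSpace M]
    [ChartedSpace (EuclideanSpace ℝ (Fin n)) M] [IsManifold (𝓡 n) ∞ M] :=
  Bundle.ContinuousRiemannianMetric (EuclideanSpace ℝ (Fin n))
    (fun x : M => TangentSpace (𝓡 n) x)

/-- `a = τ 0 < τ 1 < ⋯ < τ k = b`. -/
structure IsPartition (a b : ℝ) (k : ℕ) (τ : Fin (k + 1) → ℝ) : Prop where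
  strictMono : StrictMono τ
  left : τ 0 = a
  right : τ (Fin.last k) = b

section MetricNotions

variable {X : Type*}

/-- The set of all polygonal sums `∑ d(γ(t_{i-1}), γ(t_i))` over partitions of `[a,b]`. -/
def polygonalSums (d : X → X → ℝ) (γ : ℝ → X) (a b : ℝ) : Set ℝ :=
  {s | ∃ (k : ℕ) (τ : Fin (k + 1) → ℝ), IsPartition a b k τ ∧
    s = ∑ i : Fin k, d (γ (τ i.castSucc)) (γ (τ i.succ))}

/-- The induced length `L_d(γ)` of a path on `[a,b]`: the supremum of the polygonal sums. -/
def inducedLength (d : X → X → ℝ) (γ : ℝ → X) (a b : ℝ) : ℝ :=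
  sSup (polygonalSums d γ a b)

/-- The metric derivative at time `t` of the path `γ` on `[a,b]` exists and equals `l`:
`d(γ(s), γ(t)) / |s - t| → l` as `s → t` with `s ∈ [a,b]`, `s ≠ t`. -/
def HasMetricDeriv (d : X → X → ℝ) (γ : ℝ → X) (a b t l : ℝ) : Prop :=
  Tendsto (fun s : ℝ => d (γ s) (γ t) / |s - t|) (𝓝[Icc a b \ {t}] t) (𝓝 l)

/-- The metric derivative of the path `γ` on `[a,b]` at time `t` (meaningful where it exists). -/
def metricDeriv (d : X → X → ℝ) (γ : ℝ → X) (a b t : ℝ) : ℝ :=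
  limUnder (𝓝[Icc a b \ {t}] t) (fun s : ℝ => d (γ s) (γ t) / |s - t|)

/-- The metric arc-length: the integral over `[a,b]` of the metric derivative. -/
def metricArcLength (d : X → X → ℝ) (γ : ℝ → X) (a b : ℝ) : ℝ :=
  ∫ t in Icc a b, metricDeriv d γ a b t

end MetricNotions

section Manifold

variable {n : ℕ} {M : Type*} [TopologicalSpace M]
  [ChartedSpace (EuclideanSpace ℝ (Fin n)) M]

/-- The path `γ : [a,b] → M` is differentiable at `t ∈ [a,b]`. -/
def DifferentiableAtTime (n : ℕ) [ChartedSpace (EuclideanSpace ℝ (Fin n)) M]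
    (γ : ℝ → M) (a b t : ℝ) : Prop :=
  MDifferentiableWithinAt 𝓘(ℝ, ℝ) (𝓡 n) γ (Icc a b) t

/-- The velocity `γ'(t)` of the path `γ : [a,b] → M`, a tangent vector at `γ(t)`. -/
def velocity (n : ℕ) [ChartedSpace (EuclideanSpace ℝ (Fin n)) M]
    (γ : ℝ → M) (a b t : ℝ) : TangentSpace (𝓡 n) (γ t) :=
  mfderivWithin 𝓘(ℝ, ℝ) (𝓡 n) γ (Icc a b) t (1 : ℝ)

/-- The class of piecewise smooth paths on `[a,b]`: continuous paths that are `C^∞` (up to the end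
points) on each of the finitely many intervals of some partition of `[a,b]`. -/
def PiecewiseSmooth (n : ℕ) [ChartedSpace (EuclideanSpace ℝ (Fin n)) M]
    (γ : ℝ → M) (a b : ℝ) : Prop :=
  ContinuousOn γ (Icc a b) ∧
  ∃ (k : ℕ) (τ : Fin (k + 1) → ℝ), IsPartition a b k τ ∧
    ∀ i : Fin k, ContMDiffOn 𝓘(ℝ, ℝ) (𝓡 n) ∞ γ (Icc (τ i.castSucc) (τ i.succ))

/-- The class of absolutely continuous paths on `[a,b]`: continuous paths such that, for every
chart `u : U → ℝⁿ` of the smooth structure, `u ∘ γ` is locally absolutely continuous on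
`γ⁻¹(U)`, that is, absolutely continuous on each `[c,e] ⊆ [a,b]` with `γ([c,e]) ⊆ U`. -/
def AbsCont (n : ℕ) [ChartedSpace (EuclideanSpace ℝ (Fin n)) M]
    (γ : ℝ → M) (a b : ℝ) : Prop :=
  ContinuousOn γ (Icc a b) ∧
  ∀ u ∈ IsManifold.maximalAtlas (𝓡 n) ∞ M, ∀ c e : ℝ, c ≤ e →
    Icc c e ⊆ Icc a b ∩ γ ⁻¹' u.source →
      AbsolutelyContinuousOnInterval (fun t => u (γ t)) c e

variable [IsManifold (𝓡 n) ∞ M]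

/-- The norm `‖v‖_g = √(g_x(v,v))` of a tangent vector `v` at `x`. -/
def RMetric.norm (g : RMetric n M) (x : M) (v : TangentSpace (𝓡 n) x) : ℝ :=
  Real.sqrt (g.inner x v v)

/-- The speed `‖γ'(t)‖_g` of the path `γ : [a,b] → M`. -/
def speed (g : RMetric n M) (γ : ℝ → M) (a b t : ℝ) : ℝ :=
  g.norm (γ t) (velocity n γ a b t)

/-- The Riemannian arc-length `L(γ)`: the integral of the speed over `[a,b]`. -/
def arcLength (g : RMetric n M) (γ : ℝ → M) (a b : ℝ) : ℝ :=
  ∫ t in Icc a b, speed g γ a b t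

/-- The distance `d(p,q)` induced by `g`: the infimum of the lengths of the piecewise smooth paths
`[0,1] → M` from `p` to `q`. -/
def riemDist (g : RMetric n M) (p q : M) : ℝ :=
  sInf {r | ∃ σ : ℝ → M, PiecewiseSmooth n σ 0 1 ∧ σ 0 = p ∧ σ 1 = q ∧ r = arcLength g σ 0 1}

end Manifold

end ContRiem

end

/-! Everything rests on one local fact: for every `C > 1`, each point has a chart with convex image
in which `g` agrees with the Euclidean norm up to the factor `C` (`exists_isAdaptedChart`). In such
a chart the distance is also Euclidean up to `C` near the point, so at a time of differentiability
the quotient `d(γ(s), γ(t)) / |s - t|` is squeezed around the speed; as `C → 1`, the metric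
derivative exists and equals the speed (`DifferentiableAtTime.hasMetricDeriv`). Absolutely
continuous paths are differentiable almost everywhere, which settles the metric arc-length.

For the induced length, `t ↦ d(γ(t), γ(c))` is absolutely continuous with derivative at most the
metric derivative, so `d(γ(c), γ(e))` is at most the integral of the speed, and so is every
polygonal sum. Conversely, the induced length of `γ` on `[a,t]` is monotone in `t`, has derivative
at least the metric derivative, and increases by at least the integral of that derivative
(`inducedLength_eq_integral`).

The work is done with the distance `distC1` of continuously differentiable paths, for which Mathlib
supplies the basic theory. It equals `riemDist` (`riemDist_eq_distC1`): a `C¹` path can be replaced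
by finitely many chart segments at the cost of a factor `C ^ 2`. -/

namespace ContRiem

open Bundle

/-! ### Charts in which the metric is almost Euclidean. -/

section AdaptedCharts

variable {n : ℕ} {M : Type*} [TopologicalSpace M]
  [ChartedSpace (EuclideanSpace ℝ (Fin n)) M] [IsManifold (𝓡 n) ∞ M]

/-- This is the continuity of `g`: the trivialization at `p` carries the tangent space at `y` to the
one at `p`, and this map is nearly an isometry when `y` is near `p`. -/
theorem eventually_norm_symmL_trivializationAt (g : RMetric n M) (p : M) {r : ℝ} (hr : 1 < r) :
    ∀ᶠ y in 𝓝 p, ∀ v : TangentSpace (𝓡 n) y,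
      g.norm p ((trivializationAt (EuclideanSpace ℝ (Fin n)) (TangentSpace (𝓡 n)) p).symmL ℝ p
        ((trivializationAt (EuclideanSpace ℝ (Fin n)) (TangentSpace (𝓡 n)) p).continuousLinearMapAt
          ℝ y v)) ≤ r * g.norm y v ∧
      g.norm y v ≤ r * g.norm p
        ((trivializationAt (EuclideanSpace ℝ (Fin n)) (TangentSpace (𝓡 n)) p).symmL ℝ p
        ((trivializationAt (EuclideanSpace ℝ (Fin n)) (TangentSpace (𝓡 n)) p).continuousLinearMapAt
          ℝ y v)) := by
  let _ : RiemannianBundle (fun x : M => TangentSpace (𝓡 n) x) := ⟨g.toRiemannianMetric⟩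
  have hn : ∀ (x : M) (v : TangentSpace (𝓡 n) x), g.norm x v = ‖v‖ := fun x v => by
    rw [norm_eq_sqrt_real_inner]; rfl
  simp only [hn]
  set T := trivializationAt (EuclideanSpace ℝ (Fin n)) (TangentSpace (𝓡 n) (M := M)) p with hT
  have hp : p ∈ T.baseSet := FiberBundle.mem_baseSet_trivializationAt' p
  filter_upwards [eventually_norm_symmL_trivializationAt_self_comp_lt
    (EuclideanSpace ℝ (Fin n)) (fun x : M => TangentSpace (𝓡 n) x) p hr,
    eventually_norm_symmL_trivializationAt_comp_self_lt
    (EuclideanSpace ℝ (Fin n)) (fun x : M => TangentSpace (𝓡 n) x) p hr,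
    T.open_baseSet.mem_nhds hp] with y h1 h2 hy v
  refine ⟨?_, ?_⟩
  · exact (ContinuousLinearMap.le_of_opNorm_le _ h1.le v)
  · have := ContinuousLinearMap.le_of_opNorm_le _ h2.le (T.symmL ℝ p (T.continuousLinearMapAt ℝ y v))
    simp only [ContinuousLinearMap.comp_apply] at this
    erw [T.continuousLinearMapAt_symmL hp, T.symmL_continuousLinearMapAt hy] at this
    exact this

/-- Coordinates in an orthonormal basis for `g` at `p`. Composing a chart with `A` makes `g`
Euclidean at `p` itself. -/
theorem exists_continuousLinearEquiv_norm_eq (g : RMetric n M) (p : M) :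
    ∃ A : EuclideanSpace ℝ (Fin n) ≃L[ℝ] EuclideanSpace ℝ (Fin n), ∀ w,
      ‖A w‖ = g.norm p
        ((trivializationAt (EuclideanSpace ℝ (Fin n)) (TangentSpace (𝓡 n)) p).symmL ℝ p w) := by
  let _ : RiemannianBundle (fun x : M => TangentSpace (𝓡 n) x) := ⟨g.toRiemannianMetric⟩
  have hn : ∀ (x : M) (v : TangentSpace (𝓡 n) x), g.norm x v = ‖v‖ := fun x v => by
    rw [norm_eq_sqrt_real_inner]; rfl
  simp only [hn]
  set T := trivializationAt (EuclideanSpace ℝ (Fin n)) (TangentSpace (𝓡 n) (M := M)) p with hT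
  have hp : p ∈ T.baseSet := FiberBundle.mem_baseSet_trivializationAt' p
  let G := T.continuousLinearEquivAt ℝ p hp
  have : FiniteDimensional ℝ (TangentSpace (𝓡 n) p) :=
    inferInstanceAs (FiniteDimensional ℝ (EuclideanSpace ℝ (Fin n)))
  have hd : Module.finrank ℝ (TangentSpace (𝓡 n) p) = n := by
    rw [LinearEquiv.finrank_eq G.toLinearEquiv]; simp
  let B := ((stdOrthonormalBasis ℝ (TangentSpace (𝓡 n) p)).reindex (finCongr hd)).repr
  refine ⟨G.symm.trans B.toContinuousLinearEquiv, fun w => ?_⟩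
  simp only [ContinuousLinearEquiv.trans_apply]
  erw [B.norm_map]
  congr 1
  exact (T.symmL_apply hp w).symm

/-- The differential of `ψ : M → ℝⁿ` at `y`, as a map with values in `ℝⁿ`. -/
noncomputable def chartDeriv (ψ : M → EuclideanSpace ℝ (Fin n)) (y : M) (v : TangentSpace (𝓡 n) y) :
    EuclideanSpace ℝ (Fin n) :=
  mfderiv (𝓡 n) 𝓘(ℝ, EuclideanSpace ℝ (Fin n)) ψ y v

/-- `ψ` is a chart with convex image in which the norm of `g` differs from the Euclidean norm by a
factor of at most `C`. -/
structure IsAdaptedChart (g : RMetric n M) (C : ℝ)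
    (ψ : OpenPartialHomeomorph M (EuclideanSpace ℝ (Fin n))) : Prop where
  mem_maximalAtlas : ψ ∈ IsManifold.maximalAtlas (𝓡 n) ∞ M
  convex_target : Convex ℝ ψ.target
  norm_chartDeriv_le : ∀ y ∈ ψ.source, ∀ v : TangentSpace (𝓡 n) y,
    ‖chartDeriv ψ y v‖ ≤ C * g.norm y v
  norm_le : ∀ y ∈ ψ.source, ∀ v : TangentSpace (𝓡 n) y,
    g.norm y v ≤ C * ‖chartDeriv ψ y v‖

/-- The preferred chart followed by `A` is isometric at `p`, hence distorts by at most `C` nearby;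
cutting its image down to a small ball makes the image convex. -/
theorem exists_isAdaptedChart (g : RMetric n M) (p : M) {C : ℝ} (hC : 1 < C) {s : Set M}
    (hs : s ∈ 𝓝 p) :
    ∃ ψ : OpenPartialHomeomorph M (EuclideanSpace ℝ (Fin n)),
      IsAdaptedChart g C ψ ∧ p ∈ ψ.source ∧ ψ.source ⊆ s := by
  have hψ₀ : ∃ φ : OpenPartialHomeomorph M (EuclideanSpace ℝ (Fin n)),
      φ ∈ IsManifold.maximalAtlas (𝓡 n) ∞ M ∧ p ∈ φ.source ∧ ∀ᶠ y in 𝓝 p,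
      ∀ v : TangentSpace (𝓡 n) y,
        ‖chartDeriv φ y v‖
          ≤ C * g.norm y v ∧
        g.norm y v ≤
          C * ‖chartDeriv φ y v‖ := by
    obtain ⟨A, hA⟩ := exists_continuousLinearEquiv_norm_eq g p
    have hchart := IsManifold.chart_mem_maximalAtlas (I := 𝓡 n) (n := ∞) p
    refine ⟨(chartAt (EuclideanSpace ℝ (Fin n)) p).transHomeomorph A.toHomeomorph, ?_, ?_, ?_⟩
    · apply OpenPartialHomeomorph.mem_maximalAtlas_of_contMDiffOn
      · exact A.contDiff.contMDiff.comp_contMDiffOn (contMDiffOn_of_mem_maximalAtlas hchart)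
      · exact (contMDiffOn_symm_of_mem_maximalAtlas hchart).comp
          A.symm.contDiff.contMDiff.contMDiffOn (fun x hx => hx)
    · simp
    · filter_upwards [eventually_norm_symmL_trivializationAt g p hC,
        chart_source_mem_nhds (EuclideanSpace ℝ (Fin n)) p] with y hy hys v
      -- The tangent bundle trivialization at `p` is the differential of the preferred chart at `p`.
      have hd : chartDeriv
          ((chartAt (EuclideanSpace ℝ (Fin n)) p).transHomeomorph A.toHomeomorph) y v =
          A ((trivializationAt (EuclideanSpace ℝ (Fin n)) (TangentSpace (𝓡 n))
            p).continuousLinearMapAt ℝ y v) := by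
        unfold chartDeriv
        rw [TangentBundle.continuousLinearMapAt_trivializationAt hys]
        have : ⇑((chartAt (EuclideanSpace ℝ (Fin n)) p).transHomeomorph A.toHomeomorph) =
          A ∘ extChartAt (𝓡 n) p := by ext; simp
        rw [this, mfderiv_comp (I' := 𝓘(ℝ, EuclideanSpace ℝ (Fin n))) y
          A.differentiableAt.mdifferentiableAt (mdifferentiableAt_extChartAt hys)]
        rw [mfderiv_eq_fderiv, A.fderiv]
        rfl
      rw [hd, hA]
      exact hy v
  obtain ⟨φ, hφ, hpφ, hev⟩ := hψ₀
  have hnhds : φ.target ∩ φ.symm ⁻¹' (s ∩ {y | ∀ v : TangentSpace (𝓡 n) y,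
        ‖chartDeriv φ y v‖
          ≤ C * g.norm y v ∧
        g.norm y v ≤
          C * ‖chartDeriv φ y v‖})
      ∈ 𝓝 (φ p) := by
    refine inter_mem (φ.open_target.mem_nhds (φ.map_source hpφ)) ?_
    refine (φ.continuousAt_symm (φ.map_source hpφ)).preimage_mem_nhds ?_
    rw [φ.left_inv hpφ]
    exact inter_mem hs hev
  obtain ⟨r, hr, hball⟩ := Metric.mem_nhds_iff.1 hnhds
  have htarget : (φ.symm.restrOpen (Metric.ball (φ p) r) Metric.isOpen_ball).symm.target =
      Metric.ball (φ p) r := by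
    simpa [-Metric.mem_ball] using hball.trans inter_subset_left
  have hsource : ∀ y ∈ (φ.symm.restrOpen (Metric.ball (φ p) r) Metric.isOpen_ball).symm.source,
      y ∈ φ.source ∧ φ y ∈ Metric.ball (φ p) r := by
    intro y hy
    simpa using hy
  refine ⟨(φ.symm.restrOpen (Metric.ball (φ p) r) Metric.isOpen_ball).symm,
    ⟨?_, ?_, fun y hy v => ?_, fun y hy v => ?_⟩, ?_, fun y hy => ?_⟩
  · apply OpenPartialHomeomorph.mem_maximalAtlas_of_contMDiffOn
    · exact (contMDiffOn_of_mem_maximalAtlas hφ).mono fun y hy => (hsource y hy).1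
    · rw [htarget]
      exact (contMDiffOn_symm_of_mem_maximalAtlas hφ).mono fun y hy => (hball hy).1
  · rw [htarget]
    exact convex_ball _ _
  · have := (hball (hsource y hy).2).2.2
    rw [φ.left_inv (hsource y hy).1] at this
    exact (this v).1
  · have := (hball (hsource y hy).2).2.2
    rw [φ.left_inv (hsource y hy).1] at this
    exact (this v).2
  · simp [hpφ, hr]
  · have := (hball (hsource y hy).2).2.1
    rwa [φ.left_inv (hsource y hy).1] at this

end AdaptedCharts

/-! ### Lengths of paths and the distance of `C¹` paths, compared with charts. -/

section Curves

variable {n : ℕ} {M : Type*} [TopologicalSpace M]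
  [ChartedSpace (EuclideanSpace ℝ (Fin n)) M]

theorem differentiableAtTime_of_chart {γ : ℝ → M} {a b t : ℝ}
    (hγ : ContinuousWithinAt γ (Icc a b) t)
    {ψ : OpenPartialHomeomorph M (EuclideanSpace ℝ (Fin n))}
    (hψ : ψ ∈ IsManifold.maximalAtlas (𝓡 n) ∞ M) (htψ : γ t ∈ ψ.source)
    (h : DifferentiableWithinAt ℝ (fun s => ψ (γ s)) (Icc a b) t) :
    DifferentiableAtTime n γ a b t := by
  have h1 : MDifferentiableAt 𝓘(ℝ, EuclideanSpace ℝ (Fin n)) (𝓡 n) ψ.symm (ψ (γ t)) :=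
    (contMDiffAt_symm_of_mem_maximalAtlas hψ (ψ.map_source htψ)).mdifferentiableAt (by simp)
  have h2 : MDifferentiableWithinAt 𝓘(ℝ, ℝ) (𝓡 n) (ψ.symm ∘ fun s => ψ (γ s)) (Icc a b) t :=
    h1.comp_mdifferentiableWithinAt t h.mdifferentiableWithinAt
  refine h2.congr_of_eventuallyEq ?_ (ψ.left_inv htψ).symm
  filter_upwards [hγ (ψ.open_source.mem_nhds htψ)] with s hs
  exact (ψ.left_inv hs).symm

theorem ContMDiffOn.differentiableAtTime {γ : ℝ → M} {a b t : ℝ} {k : ℕ∞ω} (hk : k ≠ 0)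
    (hγ : ContMDiffOn 𝓘(ℝ, ℝ) (𝓡 n) k γ (Icc a b)) (ht : t ∈ Icc a b) :
    DifferentiableAtTime n γ a b t :=
  hγ.mdifferentiableOn hk t ht

theorem DifferentiableAtTime.hasDerivWithinAt {γ : ℝ → M} {a b t : ℝ}
    (hγ : DifferentiableAtTime n γ a b t)
    {ψ : OpenPartialHomeomorph M (EuclideanSpace ℝ (Fin n))}
    (hψ : ψ ∈ IsManifold.maximalAtlas (𝓡 n) ∞ M) (htψ : γ t ∈ ψ.source) :
    HasDerivWithinAt (fun s => ψ (γ s)) (chartDeriv ψ (γ t) (velocity n γ a b t)) (Icc a b) t := by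
  have h1 : MDifferentiableAt (𝓡 n) 𝓘(ℝ, EuclideanSpace ℝ (Fin n)) ψ (γ t) :=
    (contMDiffAt_of_mem_maximalAtlas hψ htψ).mdifferentiableAt (by simp)
  have h2 := h1.hasMFDerivAt.comp_hasMFDerivWithinAt t
    (MDifferentiableWithinAt.hasMFDerivWithinAt hγ)
  rw [hasMFDerivWithinAt_iff_hasFDerivWithinAt] at h2
  rw [hasDerivWithinAt_iff_hasFDerivWithinAt]
  refine HasFDerivWithinAt.congr_fderiv h2 ?_
  ext1
  exact (one_smul ℝ (chartDeriv ψ (γ t) (velocity n γ a b t))).symm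

variable [IsManifold (𝓡 n) ∞ M]

theorem speed_nonneg (g : RMetric n M) (γ : ℝ → M) (a b t : ℝ) : 0 ≤ speed g γ a b t :=
  Real.sqrt_nonneg _

/-- The length of a path as a lower Lebesgue integral. -/
noncomputable def lengthENN (g : RMetric n M) (γ : ℝ → M) (a b : ℝ) : ENNReal :=
  ∫⁻ t in Icc a b, ENNReal.ofReal (speed g γ a b t)

/-- The extended distance defined by the continuously differentiable paths. -/
noncomputable def edistC1 (g : RMetric n M) (x y : M) : ENNReal :=
  let _ : RiemannianBundle (fun x : M => TangentSpace (𝓡 n) x) := ⟨g.toRiemannianMetric⟩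
  Manifold.riemannianEDist (𝓡 n) x y

/-- The bridge to Mathlib: `g` becomes a `RiemannianBundle` instance only locally, so that the
statements below mention `g` alone. -/
theorem lengthENN_eq_pathELength (g : RMetric n M) (γ : ℝ → M) (a b : ℝ) :
    lengthENN g γ a b =
      (let _ : RiemannianBundle (fun x : M => TangentSpace (𝓡 n) x) := ⟨g.toRiemannianMetric⟩
      Manifold.pathELength (𝓡 n) γ a b) := by
  let _ : RiemannianBundle (fun x : M => TangentSpace (𝓡 n) x) := ⟨g.toRiemannianMetric⟩
  rw [Manifold.pathELength_eq_lintegral_mfderivWithin_Icc]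
  refine lintegral_congr fun t => ?_
  rw [← ofReal_norm, norm_eq_sqrt_real_inner]
  rfl

theorem lengthENN_congr (g : RMetric n M) {γ γ' : ℝ → M} {a b : ℝ} (h : EqOn γ γ' (Icc a b)) :
    lengthENN g γ a b = lengthENN g γ' a b := by
  let _ : RiemannianBundle (fun x : M => TangentSpace (𝓡 n) x) := ⟨g.toRiemannianMetric⟩
  rw [lengthENN_eq_pathELength, lengthENN_eq_pathELength]
  exact Manifold.pathELength_congr h

theorem lengthENN_add (g : RMetric n M) (γ : ℝ → M) {a b c : ℝ} (h : a ≤ b) (h' : b ≤ c) :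
    lengthENN g γ a b + lengthENN g γ b c = lengthENN g γ a c := by
  let _ : RiemannianBundle (fun x : M => TangentSpace (𝓡 n) x) := ⟨g.toRiemannianMetric⟩
  simp only [lengthENN_eq_pathELength]
  exact Manifold.pathELength_add h h'

theorem lengthENN_self (g : RMetric n M) (γ : ℝ → M) (a : ℝ) : lengthENN g γ a a = 0 := by
  simp [lengthENN]

theorem edistC1_le_lengthENN (g : RMetric n M) {γ : ℝ → M} {a b : ℝ} (hab : a ≤ b)
    (hγ : ContMDiffOn 𝓘(ℝ, ℝ) (𝓡 n) 1 γ (Icc a b)) :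
    edistC1 g (γ a) (γ b) ≤ lengthENN g γ a b := by
  let _ : RiemannianBundle (fun x : M => TangentSpace (𝓡 n) x) := ⟨g.toRiemannianMetric⟩
  rw [lengthENN_eq_pathELength]
  exact Manifold.riemannianEDist_le_pathELength hγ rfl rfl hab

theorem exists_lengthENN_lt (g : RMetric n M) {x y : M} {r : ENNReal} (h : edistC1 g x y < r) :
    ∃ γ : ℝ → M, γ 0 = x ∧ γ 1 = y ∧ ContMDiffOn 𝓘(ℝ, ℝ) (𝓡 n) 1 γ (Icc 0 1) ∧
      lengthENN g γ 0 1 < r := by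
  let _ : RiemannianBundle (fun x : M => TangentSpace (𝓡 n) x) := ⟨g.toRiemannianMetric⟩
  simp only [lengthENN_eq_pathELength]
  exact Manifold.exists_lt_of_riemannianEDist_lt h

theorem edistC1_self (g : RMetric n M) (x : M) : edistC1 g x x = 0 := by
  let _ : RiemannianBundle (fun x : M => TangentSpace (𝓡 n) x) := ⟨g.toRiemannianMetric⟩
  exact Manifold.riemannianEDist_self

theorem edistC1_comm (g : RMetric n M) (x y : M) : edistC1 g x y = edistC1 g y x := by
  let _ : RiemannianBundle (fun x : M => TangentSpace (𝓡 n) x) := ⟨g.toRiemannianMetric⟩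
  exact Manifold.riemannianEDist_comm

theorem edistC1_triangle (g : RMetric n M) (x y z : M) :
    edistC1 g x z ≤ edistC1 g x y + edistC1 g y z := by
  let _ : RiemannianBundle (fun x : M => TangentSpace (𝓡 n) x) := ⟨g.toRiemannianMetric⟩
  exact Manifold.riemannianEDist_triangle

theorem eventually_edistC1_lt (g : RMetric n M) (x : M) {c : ENNReal} (hc : 0 < c) :
    ∀ᶠ y in 𝓝 x, edistC1 g x y < c := by
  let _ : RiemannianBundle (fun x : M => TangentSpace (𝓡 n) x) := ⟨g.toRiemannianMetric⟩
  exact eventually_riemannianEDist_lt (𝓡 n) x hc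

theorem edistC1_lt_subset_nhds [T2Space M] (g : RMetric n M) {x : M} {s : Set M} (hs : s ∈ 𝓝 x) :
    ∃ c > 0, {y | edistC1 g x y < c} ⊆ s := by
  let _ : RiemannianBundle (fun x : M => TangentSpace (𝓡 n) x) := ⟨g.toRiemannianMetric⟩
  have : LocallyCompactSpace M := Manifold.locallyCompact_of_finiteDimensional (𝓡 n)
  exact setOfPred_riemannianEDist_lt_subset_nhds' (𝓡 n) hs

/-- The points at finite distance from `x` form a nonempty clopen set, by the triangle inequality.
-/
theorem edistC1_lt_top [ConnectedSpace M] (g : RMetric n M) (x y : M) : edistC1 g x y < ⊤ := by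
  have hs : IsClopen {z | edistC1 g x z < ⊤} := by
    refine ⟨⟨isOpen_iff_mem_nhds.2 fun z hz => ?_⟩, isOpen_iff_mem_nhds.2 fun z hz => ?_⟩
    · filter_upwards [eventually_edistC1_lt g z one_pos] with w hw hxw
      refine hz (lt_of_le_of_lt (edistC1_triangle g x w z) (ENNReal.add_lt_top.2 ⟨hxw, ?_⟩))
      rw [edistC1_comm]
      exact hw.trans ENNReal.one_lt_top
    · filter_upwards [eventually_edistC1_lt g z one_pos] with w hw
      exact lt_of_le_of_lt (edistC1_triangle g x z w)
        (ENNReal.add_lt_top.2 ⟨hz, hw.trans ENNReal.one_lt_top⟩)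
  have := hs.eq_univ ⟨x, by simp [edistC1_self]⟩
  exact this.ge (mem_univ y)

theorem IsAdaptedChart.enorm_sub_le {g : RMetric n M} {C : ℝ} (hC : 0 ≤ C)
    {ψ : OpenPartialHomeomorph M (EuclideanSpace ℝ (Fin n))} (hψ : IsAdaptedChart g C ψ)
    {γ : ℝ → M} {a b : ℝ} (hab : a ≤ b) (hγ : ContMDiffOn 𝓘(ℝ, ℝ) (𝓡 n) 1 γ (Icc a b))
    (hγψ : MapsTo γ (Icc a b) ψ.source) :
    ‖ψ (γ b) - ψ (γ a)‖ₑ ≤ ENNReal.ofReal C * lengthENN g γ a b := by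
  rcases hab.eq_or_lt with rfl | hab'
  · simp
  have h1 : ContDiffOn ℝ 1 (fun t => ψ (γ t)) (Icc a b) := by
    rw [← contMDiffOn_iff_contDiffOn]
    exact ((contMDiffOn_of_mem_maximalAtlas hψ.mem_maximalAtlas).of_le (by simp)).comp hγ hγψ
  refine (enorm_sub_le_lintegral_derivWithin_Icc_of_contDiffOn_Icc h1 hab).trans ?_
  rw [lengthENN, ← lintegral_const_mul' _ _ ENNReal.ofReal_ne_top]
  refine setLIntegral_mono' measurableSet_Icc fun t ht => ?_
  rw [((ContMDiffOn.differentiableAtTime one_ne_zero hγ ht).hasDerivWithinAt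
    hψ.mem_maximalAtlas (hγψ ht)).derivWithin (uniqueDiffOn_Icc hab' t ht),
    ← ofReal_norm, ← ENNReal.ofReal_mul hC]
  exact ENNReal.ofReal_le_ofReal (hψ.norm_chartDeriv_le _ (hγψ ht) _)

/-- The path is the preimage of a straight segment, which lies in the image of the chart by
convexity. -/
theorem IsAdaptedChart.exists_segment {g : RMetric n M} {C : ℝ} (hC : 0 ≤ C)
    {ψ : OpenPartialHomeomorph M (EuclideanSpace ℝ (Fin n))} (hψ : IsAdaptedChart g C ψ)
    {x y : M} (hx : x ∈ ψ.source) (hy : y ∈ ψ.source) {a b : ℝ} (hab : a < b) :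
    ∃ ρ : ℝ → M, ρ a = x ∧ ρ b = y ∧ ContMDiffOn 𝓘(ℝ, ℝ) (𝓡 n) ∞ ρ (Icc a b) ∧
      lengthENN g ρ a b ≤ ENNReal.ofReal (C * ‖ψ y - ψ x‖) := by
  have hba : 0 < b - a := sub_pos.2 hab
  let l : ℝ → EuclideanSpace ℝ (Fin n) := fun t => ψ x + ((t - a) / (b - a)) • (ψ y - ψ x)
  have hl : MapsTo l (Icc a b) ψ.target := fun t ht =>
    hψ.convex_target.add_smul_sub_mem (ψ.map_source hx) (ψ.map_source hy)
      ⟨div_nonneg (sub_nonneg.2 ht.1) hba.le, (div_le_one hba).2 (by linarith [ht.2])⟩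
  have hld : ∀ t, HasDerivAt l ((b - a)⁻¹ • (ψ y - ψ x)) t := fun t => by
    have := ((((hasDerivAt_id t).sub_const a).div_const (b - a)).smul_const
      (ψ y - ψ x)).const_add (ψ x)
    rw [one_div] at this
    exact this
  have hlc : ContDiff ℝ ∞ l := by fun_prop
  have hρ : ContMDiffOn 𝓘(ℝ, ℝ) (𝓡 n) ∞ (fun t => ψ.symm (l t)) (Icc a b) :=
    (contMDiffOn_symm_of_mem_maximalAtlas hψ.mem_maximalAtlas).comp
      hlc.contMDiff.contMDiffOn hl
  refine ⟨fun t => ψ.symm (l t), by simp [l, hx], by simp [l, hba.ne', hy], hρ, ?_⟩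
  have hsp : ∀ t ∈ Icc a b, ENNReal.ofReal (speed g (fun t => ψ.symm (l t)) a b t) ≤
      ENNReal.ofReal (C * ((b - a)⁻¹ * ‖ψ y - ψ x‖)) := fun t ht => by
    have hs := ψ.map_target (hl ht)
    refine ENNReal.ofReal_le_ofReal ((hψ.norm_le _ hs _).trans_eq ?_)
    have h1 := (ContMDiffOn.differentiableAtTime (by simp) hρ ht).hasDerivWithinAt
      hψ.mem_maximalAtlas hs
    have h2 : HasDerivWithinAt (fun s => ψ (ψ.symm (l s))) ((b - a)⁻¹ • (ψ y - ψ x)) (Icc a b) t :=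
      (hld t).hasDerivWithinAt.congr (fun s hs => ψ.right_inv (hl hs)) (ψ.right_inv (hl ht))
    rw [(uniqueDiffOn_Icc hab t ht).eq_deriv _ h1 h2, norm_smul, Real.norm_of_nonneg (by positivity)]
  refine (setLIntegral_mono' measurableSet_Icc hsp).trans_eq ?_
  rw [setLIntegral_const, Real.volume_Icc, ← ENNReal.ofReal_mul (by positivity)]
  congr 1
  field_simp

theorem IsAdaptedChart.edistC1_le {g : RMetric n M} {C : ℝ} (hC : 0 ≤ C)
    {ψ : OpenPartialHomeomorph M (EuclideanSpace ℝ (Fin n))} (hψ : IsAdaptedChart g C ψ)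
    {x y : M} (hx : x ∈ ψ.source) (hy : y ∈ ψ.source) :
    edistC1 g x y ≤ ENNReal.ofReal (C * ‖ψ y - ψ x‖) := by
  obtain ⟨ρ, rfl, rfl, hρ, hl⟩ := hψ.exists_segment hC hx hy zero_lt_one
  exact (edistC1_le_lengthENN g zero_le_one (hρ.of_le (by simp))).trans hl

/-- A competing path might leave the chart, but not if it is shorter than the radius `c` of a ball
around `p` contained in `ψ.source`; nearly optimal paths to points close to `p` are that short. -/
theorem IsAdaptedChart.eventually_enorm_sub_le [T2Space M] {g : RMetric n M} {C : ℝ} (hC : 0 ≤ C)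
    {ψ : OpenPartialHomeomorph M (EuclideanSpace ℝ (Fin n))} (hψ : IsAdaptedChart g C ψ)
    {p : M} (hp : p ∈ ψ.source) :
    ∀ᶠ y in 𝓝 p, ‖ψ y - ψ p‖ₑ ≤ ENNReal.ofReal C * edistC1 g p y := by
  obtain ⟨c, hc, hcs⟩ := edistC1_lt_subset_nhds g (ψ.open_source.mem_nhds hp)
  filter_upwards [eventually_edistC1_lt g p hc] with y hy
  have key : ∀ r, edistC1 g p y < r → r < c → ‖ψ y - ψ p‖ₑ ≤ ENNReal.ofReal C * r := by
    intro r hr hrc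
    obtain ⟨γ, rfl, rfl, hγ, hl⟩ := exists_lengthENN_lt g hr
    refine (hψ.enorm_sub_le hC zero_le_one hγ fun t ht => hcs ?_).trans
      (mul_le_mul_right hl.le _)
    refine lt_of_le_of_lt ?_ (hl.trans hrc)
    rw [← lengthENN_add g γ ht.1 ht.2]
    exact (edistC1_le_lengthENN g ht.1 (hγ.mono (Icc_subset_Icc_right ht.2))).trans le_self_add
  have hne : (𝓝[>] (edistC1 g p y)).NeBot := nhdsGT_neBot_of_exists_gt ⟨c, hy⟩
  refine ge_of_tendsto (x := 𝓝[>] (edistC1 g p y)) (f := fun r => ENNReal.ofReal C * r)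
    ((ENNReal.Tendsto.const_mul tendsto_id (Or.inr ENNReal.ofReal_ne_top)).mono_left
      nhdsWithin_le_nhds) ?_
  filter_upwards [self_mem_nhdsWithin, nhdsWithin_le_nhds (Iio_mem_nhds hy)] with r h1 h2
  exact key r h1 h2

end Curves

/-! ### The real-valued distance and the metric derivative at points of differentiability. -/

section Distance

variable {n : ℕ} {M : Type*} [TopologicalSpace M]
  [ChartedSpace (EuclideanSpace ℝ (Fin n)) M] [IsManifold (𝓡 n) ∞ M]

/-- The distance defined by the continuously differentiable paths. -/
noncomputable def distC1 (g : RMetric n M) (x y : M) : ℝ := (edistC1 g x y).toReal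

theorem distC1_nonneg (g : RMetric n M) (x y : M) : 0 ≤ distC1 g x y := ENNReal.toReal_nonneg

theorem distC1_self (g : RMetric n M) (x : M) : distC1 g x x = 0 := by
  simp [distC1, edistC1_self]

theorem distC1_comm (g : RMetric n M) (x y : M) : distC1 g x y = distC1 g y x := by
  rw [distC1, edistC1_comm, distC1]

theorem distC1_triangle [ConnectedSpace M] (g : RMetric n M) (x y z : M) :
    distC1 g x z ≤ distC1 g x y + distC1 g y z := by
  rw [distC1, distC1, distC1,
    ← ENNReal.toReal_add (edistC1_lt_top g x y).ne (edistC1_lt_top g y z).ne]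
  exact ENNReal.toReal_mono (ENNReal.add_ne_top.2 ⟨(edistC1_lt_top g x y).ne,
    (edistC1_lt_top g y z).ne⟩) (edistC1_triangle g x y z)

theorem continuous_distC1 [ConnectedSpace M] (g : RMetric n M) :
    Continuous fun q : M × M => distC1 g q.1 q.2 := by
  have hev : ∀ (x : M) (ε : ℝ), 0 < ε → ∀ᶠ y in 𝓝 x, distC1 g x y < ε := fun x ε hε => by
    filter_upwards [eventually_edistC1_lt g x (ENNReal.ofReal_pos.2 hε)] with y hy
    exact (ENNReal.lt_ofReal_iff_toReal_lt (edistC1_lt_top g x y).ne).1 hy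
  refine continuous_iff_continuousAt.2 fun q => Metric.tendsto_nhds.2 fun ε hε => ?_
  rw [nhds_prod_eq]
  filter_upwards [(hev q.1 (ε / 2) (half_pos hε)).prod_mk (hev q.2 (ε / 2) (half_pos hε))]
    with z hz
  have h1 := distC1_triangle g q.1 z.1 q.2
  have h2 := distC1_triangle g z.1 z.2 q.2
  have h3 := distC1_triangle g z.1 q.1 z.2
  have h4 := distC1_triangle g q.1 q.2 z.2
  rw [distC1_comm g z.2 q.2] at h2
  rw [distC1_comm g z.1 q.1] at h3
  rw [Real.dist_eq, abs_lt]
  constructor <;> linarith [hz.1, hz.2]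

theorem IsAdaptedChart.distC1_le {g : RMetric n M} {C : ℝ} (hC : 0 ≤ C)
    {ψ : OpenPartialHomeomorph M (EuclideanSpace ℝ (Fin n))} (hψ : IsAdaptedChart g C ψ)
    {x y : M} (hx : x ∈ ψ.source) (hy : y ∈ ψ.source) :
    distC1 g x y ≤ C * ‖ψ y - ψ x‖ :=
  ENNReal.toReal_le_of_le_ofReal (by positivity) (hψ.edistC1_le hC hx hy)

theorem IsAdaptedChart.eventually_norm_sub_le [T2Space M] [ConnectedSpace M] {g : RMetric n M}
    {C : ℝ} (hC : 0 ≤ C) {ψ : OpenPartialHomeomorph M (EuclideanSpace ℝ (Fin n))}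
    (hψ : IsAdaptedChart g C ψ) {p : M} (hp : p ∈ ψ.source) :
    ∀ᶠ y in 𝓝 p, ‖ψ y - ψ p‖ ≤ C * distC1 g p y := by
  filter_upwards [hψ.eventually_enorm_sub_le hC hp] with y hy
  have := ENNReal.toReal_mono
    (ENNReal.mul_ne_top ENNReal.ofReal_ne_top (edistC1_lt_top g p y).ne) hy
  rwa [toReal_enorm, ENNReal.toReal_mul, ENNReal.toReal_ofReal hC] at this

theorem nhdsWithin_Icc_diff_neBot {a b t : ℝ} (hab : a < b) (ht : t ∈ Icc a b) :
    (𝓝[Icc a b \ {t}] t).NeBot := by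
  have := (uniqueDiffOn_Icc hab t ht).accPt
  rwa [accPt_principal_iff_nhdsWithin] at this

theorem HasMetricDeriv.metricDeriv_eq {X : Type*} {d : X → X → ℝ} {γ : ℝ → X} {a b t l : ℝ}
    (hab : a < b) (ht : t ∈ Icc a b) (h : HasMetricDeriv d γ a b t l) :
    metricDeriv d γ a b t = l :=
  have := nhdsWithin_Icc_diff_neBot hab ht
  h.limUnder_eq

theorem DifferentiableAtTime.hasMetricDeriv [T2Space M] [ConnectedSpace M] (g : RMetric n M)
    {γ : ℝ → M} {a b t : ℝ} (hγ : DifferentiableAtTime n γ a b t) :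
    HasMetricDeriv (distC1 g) γ a b t (speed g γ a b t) := by
  have hcont : Tendsto γ (𝓝[Icc a b \ {t}] t) (𝓝 (γ t)) :=
    (MDifferentiableWithinAt.continuousWithinAt hγ).tendsto.mono_left
      (nhdsWithin_mono _ sdiff_subset)
  -- `q` is the Euclidean difference quotient in an adapted chart and `l` its limit, the norm of the
  -- velocity in the chart.
  have key : ∀ C : ℝ, 1 < C → ∃ (l : ℝ) (q : ℝ → ℝ), l ≤ C * speed g γ a b t ∧
      speed g γ a b t ≤ C * l ∧ Tendsto q (𝓝[Icc a b \ {t}] t) (𝓝 l) ∧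
      ∀ᶠ s in 𝓝[Icc a b \ {t}] t, q s ≤ C * (distC1 g (γ s) (γ t) / |s - t|) ∧
        distC1 g (γ s) (γ t) / |s - t| ≤ C * q s := by
    intro C hC
    have hC0 : 0 ≤ C := by linarith
    obtain ⟨ψ, hψ, hpψ, -⟩ := exists_isAdaptedChart g (γ t) hC univ_mem
    have hder := hγ.hasDerivWithinAt hψ.mem_maximalAtlas hpψ
    refine ⟨_, fun s => ‖slope (fun s => ψ (γ s)) t s‖, hψ.norm_chartDeriv_le _ hpψ _,
      hψ.norm_le _ hpψ _, (hasDerivWithinAt_iff_tendsto_slope.1 hder).norm, ?_⟩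
    filter_upwards [hcont (ψ.open_source.mem_nhds hpψ), hcont (hψ.eventually_norm_sub_le hC0 hpψ)]
      with s hs1 hs2
    have hq : ‖slope (fun s => ψ (γ s)) t s‖ = ‖ψ (γ s) - ψ (γ t)‖ / |s - t| := by
      rw [slope_def_module, norm_smul, norm_inv, Real.norm_eq_abs, div_eq_inv_mul]
    rw [hq, distC1_comm, ← mul_div_assoc, ← mul_div_assoc]
    exact ⟨div_le_div_of_nonneg_right hs2 (abs_nonneg _),
      div_le_div_of_nonneg_right (hψ.distC1_le hC0 hpψ hs1) (abs_nonneg _)⟩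
  -- One factor `C` is lost between `l` and the speed, another between `q` and the metric quotient.
  have hlim : ∀ c : ℝ, Tendsto (fun C : ℝ => c * C ^ 2) (𝓝[>] 1) (𝓝 c) := fun c => by
    have : Tendsto (fun C : ℝ => c * C ^ 2) (𝓝 1) (𝓝 (c * 1 ^ 2)) :=
      (by fun_prop : Continuous fun C : ℝ => c * C ^ 2).tendsto 1
    simpa using this.mono_left nhdsWithin_le_nhds
  refine tendsto_order.2 ⟨fun c hc => ?_, fun c hc => ?_⟩
  · obtain ⟨C, hCc, hC⟩ := (((hlim c).eventually_lt_const hc).and self_mem_nhdsWithin).exists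
    have hC0 : (0 : ℝ) < C := zero_lt_one.trans hC
    obtain ⟨l, q, -, hl, hq, hev⟩ := key C hC
    have hcl : c * C < l := by
      refine lt_of_mul_lt_mul_left (a := C) ?_ hC0.le
      calc C * (c * C) = c * C ^ 2 := by ring
        _ < _ := hCc
        _ ≤ _ := hl
    filter_upwards [hev, hq.eventually_const_lt hcl] with s hs1 hs2
    refine lt_of_mul_lt_mul_left (a := C) ?_ hC0.le
    linarith [hs1.1]
  · obtain ⟨C, hCc, hC⟩ := (((hlim (speed g γ a b t)).eventually_lt_const hc).and
      self_mem_nhdsWithin).exists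
    have hC0 : (0 : ℝ) < C := zero_lt_one.trans hC
    obtain ⟨l, q, hl, -, hq, hev⟩ := key C hC
    have hcl : l < c / C := by
      rw [lt_div_iff₀ hC0]
      calc l * C ≤ C * speed g γ a b t * C := by gcongr
        _ = speed g γ a b t * C ^ 2 := by ring
        _ < c := hCc
    filter_upwards [hev, hq.eventually_lt_const hcl] with s hs1 hs2
    calc _ ≤ C * q s := hs1.2
      _ < C * (c / C) := by gcongr
      _ = c := by field_simp

end Distance

/-! ### Absolutely continuous functions on an interval. -/

section AbsolutelyContinuous

theorem _root_.AbsolutelyContinuousOnInterval.of_dist_le_mul {X Y : Type*} [PseudoMetricSpace X]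
    [PseudoMetricSpace Y] {f : ℝ → X} {F : ℝ → Y} {a b C : ℝ}
    (hf : AbsolutelyContinuousOnInterval f a b)
    (h : ∀ x ∈ uIcc a b, ∀ y ∈ uIcc a b, dist (F x) (F y) ≤ C * dist (f x) (f y)) :
    AbsolutelyContinuousOnInterval F a b := by
  have h0 := Tendsto.const_mul C hf
  rw [mul_zero] at h0
  refine squeeze_zero' (Eventually.of_forall fun E => Finset.sum_nonneg fun i _ => dist_nonneg)
    ?_ h0
  filter_upwards [mem_inf_of_right (mem_principal_self _)] with E hE
  rw [Finset.mul_sum]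
  exact Finset.sum_le_sum fun i hi => h _ (hE.1 i hi).1 _ (hE.1 i hi).2

/-- The metric derivative bounds the distance between the end points of a path whose distance
from its starting point is absolutely continuous. -/
theorem dist_le_integral_of_hasMetricDeriv {X : Type*} {d : X → X → ℝ} (hself : ∀ x, d x x = 0)
    (hcomm : ∀ x y, d x y = d y x) (htri : ∀ x y z, d x z ≤ d x y + d y z)
    {γ : ℝ → X} {a b c e : ℝ} (hce : c ≤ e) (hsub : Icc c e ⊆ Icc a b) {m : ℝ → ℝ}
    (hm : IntegrableOn m (Icc c e))
    (hd : ∀ᵐ t ∂(volume.restrict (Icc c e)), HasMetricDeriv d γ a b t (m t))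
    (hF : AbsolutelyContinuousOnInterval (fun t => d (γ t) (γ c)) c e) :
    d (γ c) (γ e) ≤ ∫ t in c..e, m t := by
  have hint := hF.integral_deriv_eq_sub
  rw [hself, sub_zero] at hint
  rw [hcomm, ← hint]
  have hmi : IntervalIntegrable m volume c e :=
    (intervalIntegrable_iff_integrableOn_Icc_of_le hce).2 hm
  refine intervalIntegral.integral_mono_ae_restrict hce hF.intervalIntegrable_deriv hmi ?_
  have hne : ∀ᵐ t ∂(volume.restrict (Icc c e)), t ≠ e :=
    ae_restrict_of_ae (by simp [ae_iff, measure_singleton])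
  filter_upwards [hd, hne, ae_restrict_of_ae hF.ae_differentiableAt,
    ae_restrict_mem measurableSet_Icc] with t h1 h2 h3 ht
  have hte : t < e := lt_of_le_of_ne ht.2 h2
  -- Both derivatives exist, so they can be compared through right-hand quotients, where the
  -- triangle inequality gives the bound.
  have hsl := (hasDerivAt_iff_tendsto_slope.1 (h3 (by rwa [uIcc_of_le hce])).hasDerivAt).mono_left
    (nhdsWithin_mono t (fun s (hs : s ∈ Ioi t) => ne_of_gt hs))
  have hle : 𝓝[>] t ≤ 𝓝[Icc a b \ {t}] t := by
    refine nhdsWithin_le_of_mem ?_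
    filter_upwards [Ioc_mem_nhdsGT hte] with s hs
    exact ⟨hsub ⟨ht.1.trans hs.1.le, hs.2⟩, ne_of_gt hs.1⟩
  refine le_of_tendsto_of_tendsto hsl (h1.mono_left hle) ?_
  filter_upwards [self_mem_nhdsWithin] with s hs
  have hst : 0 < s - t := sub_pos.2 hs
  rw [slope_def_field, abs_of_pos hst]
  gcongr
  linarith [htri (γ s) (γ t) (γ c)]

theorem _root_.AbsolutelyContinuousOnInterval.euclidean_apply {n : ℕ}
    {f : ℝ → EuclideanSpace ℝ (Fin n)} {a b : ℝ} (hf : AbsolutelyContinuousOnInterval f a b)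
    (i : Fin n) : AbsolutelyContinuousOnInterval (fun t => f t i) a b :=
  hf.of_dist_le_mul (C := 1) fun x _ y _ => by
    rw [one_mul, EuclideanSpace.dist_eq, Real.dist_eq]
    refine Real.le_sqrt_of_sq_le ?_
    rw [← Real.dist_eq]
    exact Finset.single_le_sum (f := fun j => dist (f x j) (f y j) ^ 2)
      (fun j _ => sq_nonneg _) (Finset.mem_univ i)

theorem _root_.AbsolutelyContinuousOnInterval.ae_differentiableAt_euclidean {n : ℕ}
    {f : ℝ → EuclideanSpace ℝ (Fin n)} {a b : ℝ} (hf : AbsolutelyContinuousOnInterval f a b) :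
    ∀ᵐ t, t ∈ uIcc a b → DifferentiableAt ℝ f t := by
  filter_upwards [ae_all_iff.2 fun i => (hf.euclidean_apply i).ae_differentiableAt] with t ht hmem
  exact differentiableAt_euclidean.2 fun i => ht i hmem

/-- The Euclidean norm is at most the sum of the absolute values of the coordinates, and each
coordinate has an integrable derivative. -/
theorem _root_.AbsolutelyContinuousOnInterval.exists_integrable_bound_deriv {n : ℕ}
    {f : ℝ → EuclideanSpace ℝ (Fin n)} {a b : ℝ} (hf : AbsolutelyContinuousOnInterval f a b) :
    ∃ h : ℝ → ℝ, IntervalIntegrable h volume a b ∧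
      ∀ t, DifferentiableAt ℝ f t → ‖deriv f t‖ ≤ h t := by
  refine ⟨fun t => ∑ i, |deriv (fun s => f s i) t|, ?_, fun t ht => ?_⟩
  · have := IntervalIntegrable.sum (Finset.univ : Finset (Fin n))
      (fun i _ => ((hf.euclidean_apply i).intervalIntegrable_deriv).abs)
    refine this.congr fun t _ => ?_
    simp
  · have hi : ∀ i, deriv (fun s => f s i) t = deriv f t i := fun i =>
      ((EuclideanSpace.proj (𝕜 := ℝ) i).hasFDerivAt.comp_hasDerivAt t ht.hasDerivAt).deriv
    simp only [hi]
    rw [EuclideanSpace.norm_eq]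
    refine Real.sqrt_le_iff.2 ⟨Finset.sum_nonneg fun i _ => abs_nonneg _, ?_⟩
    exact Finset.sum_sq_le_sq_sum_of_nonneg fun i _ => abs_nonneg _

end AbsolutelyContinuous

/-! ### Polygonal sums and the induced length. -/

section PolygonalSums

variable {X : Type*} {d : X → X → ℝ} {γ : ℝ → X} {a b : ℝ}

theorem IsPartition.mem_Icc {k : ℕ} {τ : Fin (k + 1) → ℝ} (h : IsPartition a b k τ)
    (i : Fin (k + 1)) : τ i ∈ Icc a b :=
  ⟨h.left ▸ h.strictMono.monotone (Fin.zero_le i), h.right ▸ h.strictMono.monotone (Fin.le_last i)⟩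

theorem isPartition_self (a : ℝ) : IsPartition a a 0 fun _ => a :=
  ⟨fun i j h => absurd h (by omega), rfl, rfl⟩

theorem IsPartition.snoc {k : ℕ} {τ : Fin (k + 1) → ℝ} (h : IsPartition a b k τ) {c : ℝ}
    (hbc : b < c) : IsPartition a c (k + 1) (Fin.snoc (α := fun _ => ℝ) τ c) := by
  refine ⟨Fin.strictMono_iff_lt_succ.2 fun i => ?_, ?_, Fin.snoc_last _ _⟩
  · refine Fin.lastCases ?_ (fun j => ?_) i
    · rw [Fin.succ_last, Fin.snoc_last, Fin.snoc_castSucc, h.right]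
      exact hbc
    · rw [Fin.succ_castSucc, Fin.snoc_castSucc, Fin.snoc_castSucc]
      exact h.strictMono Fin.castSucc_lt_succ
  · rw [← Fin.castSucc_zero, Fin.snoc_castSucc, h.left]

theorem zero_mem_polygonalSums : (0 : ℝ) ∈ polygonalSums d γ a a :=
  ⟨0, _, isPartition_self a, by simp⟩

theorem add_mem_polygonalSums {s c : ℝ} (hs : s ∈ polygonalSums d γ a b) (hbc : b < c) :
    s + d (γ b) (γ c) ∈ polygonalSums d γ a c := by
  obtain ⟨k, τ, hτ, rfl⟩ := hs
  refine ⟨k + 1, _, hτ.snoc hbc, ?_⟩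
  rw [Fin.sum_univ_castSucc]
  congr 1
  · refine Finset.sum_congr rfl fun i _ => ?_
    rw [Fin.succ_castSucc, Fin.snoc_castSucc, Fin.snoc_castSucc]
  · rw [Fin.succ_last, Fin.snoc_last, Fin.snoc_castSucc, hτ.right]

theorem nonempty_polygonalSums (hab : a ≤ b) : (polygonalSums d γ a b).Nonempty := by
  rcases hab.eq_or_lt with rfl | hab
  · exact ⟨0, zero_mem_polygonalSums⟩
  · exact ⟨_, add_mem_polygonalSums zero_mem_polygonalSums hab⟩

theorem le_integral_of_mem_polygonalSums {m : ℝ → ℝ} {c : ℝ} (hac : a ≤ c) (hcb : c ≤ b)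
    (hm : IntegrableOn m (Icc a b))
    (hd : ∀ s t, a ≤ s → s ≤ t → t ≤ b → d (γ s) (γ t) ≤ ∫ x in s..t, m x) {r : ℝ}
    (hr : r ∈ polygonalSums d γ a c) : r ≤ ∫ x in a..c, m x := by
  obtain ⟨k, τ, hτ, rfl⟩ := hr
  have hi : ∀ s ∈ Icc a b, ∀ t ∈ Icc a b, IntervalIntegrable m volume s t := fun s hs t ht =>
    (hm.mono_set (uIcc_subset_Icc hs ht)).intervalIntegrable
  have ha : a ∈ Icc a b := ⟨le_rfl, hac.trans hcb⟩
  have hmem : ∀ i, τ i ∈ Icc a b := fun i => Icc_subset_Icc_right hcb (hτ.mem_Icc i)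
  have h1 : ∀ i : Fin k, d (γ (τ i.castSucc)) (γ (τ i.succ)) ≤
      (∫ x in a..τ i.succ, m x) - ∫ x in a..τ i.castSucc, m x := fun i => by
    rw [intervalIntegral.integral_interval_sub_left (hi _ ha _ (hmem _)) (hi _ ha _ (hmem _))]
    exact hd _ _ (hmem _).1 (hτ.strictMono.monotone Fin.castSucc_lt_succ.le) (hmem _).2
  refine (Finset.sum_le_sum fun i _ => h1 i).trans_eq ?_
  -- Telescoping: the sum over all `k + 1` nodes is split off at its first and at its last term.
  have h2 := Fin.sum_univ_succ fun i => ∫ x in a..τ i, m x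
  rw [Fin.sum_univ_castSucc, hτ.left, hτ.right, intervalIntegral.integral_same] at h2
  rw [Finset.sum_sub_distrib]
  linarith

/-- If `m` is integrable, is almost everywhere the metric derivative, and its integrals bound the
distances along the path, then the induced length is the integral of `m`. -/
theorem inducedLength_eq_integral (hab : a < b) {m : ℝ → ℝ} (hd0 : ∀ x y, 0 ≤ d x y)
    (hcomm : ∀ x y, d x y = d y x)
    (hm : IntegrableOn m (Icc a b))
    (hd : ∀ s t, a ≤ s → s ≤ t → t ≤ b → d (γ s) (γ t) ≤ ∫ x in s..t, m x)
    (hder : ∀ᵐ t ∂(volume.restrict (Icc a b)), HasMetricDeriv d γ a b t (m t)) :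
    BddAbove (polygonalSums d γ a b) ∧ inducedLength d γ a b = ∫ x in a..b, m x := by
  have hub : ∀ c ∈ Icc a b, ∀ r ∈ polygonalSums d γ a c, r ≤ ∫ x in a..c, m x :=
    fun c hc r hr => le_integral_of_mem_polygonalSums hc.1 hc.2 hm hd hr
  have hbdd : ∀ c ∈ Icc a b, BddAbove (polygonalSums d γ a c) := fun c hc => ⟨_, hub c hc⟩
  have hb : b ∈ Icc a b := ⟨hab.le, le_rfl⟩
  have ha : a ∈ Icc a b := ⟨le_rfl, hab.le⟩
  refine ⟨hbdd b hb, le_antisymm (csSup_le (nonempty_polygonalSums hab.le) (hub b hb)) ?_⟩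
  -- A partition of `[a,s]` extended by the node `t` is a partition of `[a,t]`.
  have hstep : ∀ s ∈ Icc a b, ∀ t ∈ Icc a b, s < t →
      inducedLength d γ a s + d (γ s) (γ t) ≤ inducedLength d γ a t := by
    intro s hs t ht hst
    rw [← le_sub_iff_add_le]
    refine csSup_le (nonempty_polygonalSums hs.1) fun r hr => ?_
    rw [le_sub_iff_add_le]
    exact le_csSup (hbdd t ht) (add_mem_polygonalSums hr hst)
  have hmono : MonotoneOn (inducedLength d γ a) (uIcc a b) := by
    rw [uIcc_of_le hab.le]
    intro s hs t ht hst
    rcases hst.eq_or_lt with rfl | hst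
    · exact le_rfl
    · linarith [hstep s hs t ht hst, hd0 (γ s) (γ t)]
  have ha0 : 0 ≤ inducedLength d γ a a := le_csSup (hbdd a ha) zero_mem_polygonalSums
  -- Lebesgue's inequality for monotone functions; absolute continuity of the length function is not
  -- needed.
  have hle : ∫ x in a..b, deriv (inducedLength d γ a) x ≤ inducedLength d γ a b := by
    have := hmono.intervalIntegral_deriv_mem_uIcc
    rw [uIcc_of_le (sub_nonneg.2 (hmono left_mem_uIcc right_mem_uIcc hab.le))] at this
    linarith [this.2]
  refine le_trans ?_ hle
  refine intervalIntegral.integral_mono_ae_restrict hab.le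
    ((intervalIntegrable_iff_integrableOn_Icc_of_le hab.le).2 hm)
    hmono.intervalIntegrable_deriv ?_
  have hne : ∀ c : ℝ, ∀ᵐ t ∂(volume.restrict (Icc a b)), t ≠ c := fun c =>
    ae_restrict_of_ae (by simp [ae_iff, measure_singleton])
  filter_upwards [hder, hne a, hne b, ae_restrict_of_ae hmono.ae_differentiableWithinAt_of_mem,
    ae_restrict_mem measurableSet_Icc] with t h1 h2 h3 h4 ht
  have hat : a < t := lt_of_le_of_ne ht.1 (Ne.symm h2)
  have htb : t < b := lt_of_le_of_ne ht.2 h3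
  rw [uIcc_of_le hab.le] at h4
  have hsl := (hasDerivAt_iff_tendsto_slope.1
    ((h4 ht).differentiableAt (Icc_mem_nhds hat htb)).hasDerivAt).mono_left
    (nhdsWithin_mono t (fun s (hs : s ∈ Ioi t) => ne_of_gt hs))
  have hIoc : ∀ᶠ s in 𝓝[>] t, s ∈ Ioc t b := Ioc_mem_nhdsGT htb
  have hto : 𝓝[>] t ≤ 𝓝[Icc a b \ {t}] t := by
    refine nhdsWithin_le_of_mem ?_
    filter_upwards [hIoc] with s hs
    exact ⟨⟨hat.le.trans hs.1.le, hs.2⟩, ne_of_gt hs.1⟩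
  refine le_of_tendsto_of_tendsto (h1.mono_left hto) hsl ?_
  filter_upwards [hIoc] with s hs
  have hst : 0 < s - t := sub_pos.2 hs.1
  rw [slope_def_field, abs_of_pos hst]
  gcongr
  rw [hcomm]
  linarith [hstep t ht s ⟨hat.le.trans hs.1.le, hs.2⟩ hs.1]

end PolygonalSums

/-! ### Absolutely continuous paths in the manifold. -/

section AbsolutelyContinuousPaths

/-- Compactness of `[a,b]` reduces statements about `γ` to pieces lying in a single chart. The nodes
may repeat. -/
theorem exists_partition_mapsTo {X : Type*} [TopologicalSpace X] {γ : ℝ → X} {a b : ℝ}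
    (hab : a ≤ b) (hγ : ContinuousOn γ (Icc a b)) {Q : Set X → Prop}
    (hQ : ∀ p, ∃ U, IsOpen U ∧ p ∈ U ∧ Q U) :
    ∃ (t : ℕ → ℝ) (m : ℕ), Monotone t ∧ t 0 = a ∧ t m = b ∧ (∀ i, t i ∈ Icc a b) ∧
      ∀ i, ∃ U, Q U ∧ MapsTo γ (Icc (t i) (t (i + 1))) U := by
  choose U hU hpU hQU using hQ
  obtain ⟨t, h0, hmono, ⟨m, hm⟩, ht⟩ := exists_monotone_Icc_subset_open_cover_Icc hab
    (c := fun p => (Icc a b).domRestrict γ ⁻¹' U p)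
    (fun p => (hU p).preimage hγ.domRestrict) (fun s _ => mem_iUnion.2 ⟨γ s, hpU _⟩)
  refine ⟨fun i => t i, m, fun i j hij => hmono hij, h0, hm m le_rfl, fun i => (t i).2,
    fun i => ?_⟩
  obtain ⟨p, hp⟩ := ht i
  refine ⟨U p, hQU p, fun s hs => ?_⟩
  exact hp (a := ⟨s, (t i).2.1.trans hs.1, hs.2.trans (t (i + 1)).2.2⟩) ⟨hs.1, hs.2⟩

/-- As `t` is not assumed monotone, the case `m = 0` needs the singleton, which is a null set. -/
theorem Icc_subset_iUnion_Icc {t : ℕ → ℝ} (m : ℕ) :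
    Icc (t 0) (t m) ⊆ ⋃ i, Icc (t i) (t (i + 1)) ∪ {t 0} := by
  induction m with
  | zero => intro s hs; simp_all
  | succ m ih =>
    intro s hs
    rcases le_total s (t m) with h | h
    · exact ih ⟨hs.1, h⟩
    · exact mem_iUnion.2 ⟨m, Or.inl ⟨h, hs.2⟩⟩

variable {n : ℕ} {M : Type*} [TopologicalSpace M]
  [ChartedSpace (EuclideanSpace ℝ (Fin n)) M]

theorem ContMDiffOn.absCont {γ : ℝ → M} {a b : ℝ} {k : ℕ∞ω} (hk : 1 ≤ k)
    (hγ : ContMDiffOn 𝓘(ℝ, ℝ) (𝓡 n) k γ (Icc a b)) : AbsCont n γ a b := by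
  refine ⟨hγ.continuousOn, fun u hu c e hce hs => ContDiffOn.absolutelyContinuousOnInterval ?_⟩
  rw [uIcc_of_le hce, ← contMDiffOn_iff_contDiffOn]
  exact ((contMDiffOn_of_mem_maximalAtlas hu).of_le (by simp)).comp
    ((hγ.of_le hk).mono fun _ hz => (hs hz).1) fun _ hz => (hs hz).2

theorem AbsCont.ae_differentiableAtTime_of_mapsTo {γ : ℝ → M} {a b c e : ℝ}
    (hγ : AbsCont n γ a b) (hce : c ≤ e) (hsub : Icc c e ⊆ Icc a b)
    {ψ : OpenPartialHomeomorph M (EuclideanSpace ℝ (Fin n))}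
    (hψ : ψ ∈ IsManifold.maximalAtlas (𝓡 n) ∞ M) (hmaps : MapsTo γ (Icc c e) ψ.source) :
    ∀ᵐ t ∂(volume.restrict (Icc c e)), DifferentiableAtTime n γ a b t := by
  have hac := hγ.2 ψ hψ c e hce fun z hz => ⟨hsub hz, hmaps hz⟩
  filter_upwards [ae_restrict_of_ae hac.ae_differentiableAt_euclidean,
    ae_restrict_mem measurableSet_Icc] with t h1 ht
  exact differentiableAtTime_of_chart (hγ.1 t (hsub ht)) hψ (hmaps ht)
    (h1 (by rwa [uIcc_of_le hce])).differentiableWithinAt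

variable [IsManifold (𝓡 n) ∞ M]

theorem AbsCont.ae_differentiableAtTime {γ : ℝ → M} {a b : ℝ} (hab : a ≤ b)
    (hγ : AbsCont n γ a b) :
    ∀ᵐ t ∂(volume.restrict (Icc a b)), DifferentiableAtTime n γ a b t := by
  obtain ⟨t, m, hmono, h0, hm, hmem, ht⟩ := exists_partition_mapsTo hab hγ.1
    (Q := fun U => ∃ ψ ∈ IsManifold.maximalAtlas (𝓡 n) ∞ M, U = ψ.source) fun p =>
    ⟨_, (chartAt _ p).open_source, mem_chart_source _ p, _,
      IsManifold.chart_mem_maximalAtlas (I := 𝓡 n) (n := ∞) p, rfl⟩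
  subst h0 hm
  refine ae_restrict_of_ae_restrict_of_subset (Icc_subset_iUnion_Icc m) ?_
  rw [ae_restrict_iUnion_iff]
  intro i
  rw [ae_restrict_union_iff]
  obtain ⟨_, ⟨ψ, hψ, rfl⟩, hU⟩ := ht i
  exact ⟨hγ.ae_differentiableAtTime_of_mapsTo (hmono i.le_succ)
    (Icc_subset_Icc (hmem _).1 (hmem _).2) hψ hU, by simp⟩

/-- The speed is almost everywhere a limit of metric difference quotients, which are measurable
because the distance is continuous. This avoids measurability in the tangent bundle. -/
theorem aestronglyMeasurable_speed [T2Space M] [ConnectedSpace M] (g : RMetric n M) {γ : ℝ → M}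
    {a b : ℝ} (hγ : ContinuousOn γ (Icc a b))
    (hd : ∀ᵐ t ∂(volume.restrict (Icc a b)), DifferentiableAtTime n γ a b t) :
    AEStronglyMeasurable (speed g γ a b) (volume.restrict (Icc a b)) := by
  have hpos : ∀ k : ℕ, (0 : ℝ) < 1 / ((k : ℝ) + 1) := fun k => Nat.one_div_pos_of_nat
  -- Truncation at `b` keeps the shifted time in `[a,b]`; it coincides with `t` only at the null
  -- point `t = b`.
  let s : ℕ → ℝ → ℝ := fun k t => min (t + 1 / ((k : ℝ) + 1)) b
  have hsc : ∀ k, Continuous (s k) := fun k => by fun_prop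
  have hs : ∀ k, ∀ t ∈ Icc a b, s k t ∈ Icc a b := fun k t ht =>
    ⟨le_min (by linarith [hpos k, ht.1]) (ht.1.trans ht.2), min_le_right _ _⟩
  refine (aemeasurable_of_tendsto_metrizable_ae (atTop : Filter ℕ)
    (f := fun k t => distC1 g (γ (s k t)) (γ t) / |s k t - t|) (fun k => ?_) ?_).aestronglyMeasurable
  · refine AEMeasurable.div ?_ (by fun_prop : Continuous fun t => |s k t - t|).aemeasurable
    refine ContinuousOn.aemeasurable ?_ measurableSet_Icc
    exact (continuous_distC1 g).comp_continuousOn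
      ((hγ.comp (hsc k).continuousOn (hs k)).prodMk hγ)
  · have hne : ∀ᵐ t ∂(volume.restrict (Icc a b)), t ≠ b :=
      ae_restrict_of_ae (by simp [ae_iff, measure_singleton])
    filter_upwards [hd, hne, ae_restrict_mem measurableSet_Icc] with t h1 h2 ht
    have htb : t < b := lt_of_le_of_ne ht.2 h2
    refine (h1.hasMetricDeriv g).comp (tendsto_nhdsWithin_iff.2 ⟨?_, ?_⟩)
    · have h3 : Tendsto (fun k : ℕ => min (t + 1 / ((k : ℝ) + 1)) b) atTop (𝓝 (min (t + 0) b)) :=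
        (tendsto_const_nhds.add tendsto_one_div_add_atTop_nhds_zero_nat).min tendsto_const_nhds
      rwa [add_zero, min_eq_left ht.2] at h3
    · refine Eventually.of_forall fun k => ⟨hs k t ht, ?_⟩
      exact (lt_min (by linarith [hpos k]) htb).ne'

theorem AbsCont.aestronglyMeasurable_speed [T2Space M] [ConnectedSpace M] (g : RMetric n M)
    {γ : ℝ → M} {a b : ℝ} (hγ : AbsCont n γ a b) :
    AEStronglyMeasurable (speed g γ a b) (volume.restrict (Icc a b)) := by
  rcases le_or_gt a b with hab | hab
  · exact ContRiem.aestronglyMeasurable_speed g hγ.1 (hγ.ae_differentiableAtTime hab)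
  · simp [Icc_eq_empty_of_lt hab]

theorem AbsCont.integrableOn_speed_of_mapsTo [T2Space M] [ConnectedSpace M] {g : RMetric n M}
    {γ : ℝ → M} {a b c e C : ℝ} (hab : a < b) (hC : 0 ≤ C) (hγ : AbsCont n γ a b) (hce : c ≤ e)
    (hsub : Icc c e ⊆ Icc a b) {ψ : OpenPartialHomeomorph M (EuclideanSpace ℝ (Fin n))}
    (hψ : IsAdaptedChart g C ψ) (hmaps : MapsTo γ (Icc c e) ψ.source) :
    IntegrableOn (speed g γ a b) (Icc c e) := by
  have hac := hγ.2 ψ hψ.mem_maximalAtlas c e hce fun z hz => ⟨hsub hz, hmaps hz⟩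
  obtain ⟨h, hh, hbound⟩ := hac.exists_integrable_bound_deriv
  refine Integrable.mono' (((intervalIntegrable_iff_integrableOn_Icc_of_le hce).1 hh).const_mul C)
    ((hγ.aestronglyMeasurable_speed g).mono_set hsub) ?_
  filter_upwards [ae_restrict_of_ae hac.ae_differentiableAt_euclidean,
    ae_restrict_mem measurableSet_Icc] with t h1 ht
  have hd := h1 (by rwa [uIcc_of_le hce])
  have hv := (differentiableAtTime_of_chart (hγ.1 t (hsub ht)) hψ.mem_maximalAtlas (hmaps ht)
    hd.differentiableWithinAt).hasDerivWithinAt hψ.mem_maximalAtlas (hmaps ht)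
  rw [Real.norm_of_nonneg (speed_nonneg _ _ _ _ _)]
  refine (hψ.norm_le _ (hmaps ht) _).trans (mul_le_mul_of_nonneg_left ?_ hC)
  refine le_trans (le_of_eq ?_) (hbound t hd)
  rw [(uniqueDiffOn_Icc hab t (hsub ht)).eq_deriv _ hv hd.hasDerivAt.hasDerivWithinAt]

theorem AbsCont.distC1_le_integral_of_mapsTo [T2Space M] [ConnectedSpace M] {g : RMetric n M}
    {γ : ℝ → M} {a b c e C : ℝ} (hab : a < b) (hC : 0 ≤ C) (hγ : AbsCont n γ a b) (hce : c ≤ e)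
    (hsub : Icc c e ⊆ Icc a b) {ψ : OpenPartialHomeomorph M (EuclideanSpace ℝ (Fin n))}
    (hψ : IsAdaptedChart g C ψ) (hmaps : MapsTo γ (Icc c e) ψ.source) :
    distC1 g (γ c) (γ e) ≤ ∫ t in c..e, speed g γ a b t := by
  have hac := hγ.2 ψ hψ.mem_maximalAtlas c e hce fun z hz => ⟨hsub hz, hmaps hz⟩
  refine dist_le_integral_of_hasMetricDeriv (distC1_self g) (distC1_comm g) (distC1_triangle g)
    hce hsub (hγ.integrableOn_speed_of_mapsTo hab hC hce hsub hψ hmaps) ?_ ?_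
  · filter_upwards [hγ.ae_differentiableAtTime_of_mapsTo hce hsub hψ.mem_maximalAtlas hmaps]
      with t ht using ht.hasMetricDeriv g
  -- The distance to `γ c` is 1-Lipschitz for `distC1`, which is at most `C` times the distance in
  -- the chart.
  · refine hac.of_dist_le_mul (C := C) fun x hx y hy => ?_
    rw [uIcc_of_le hce] at hx hy
    have h0 := hψ.distC1_le hC (hmaps hx) (hmaps hy)
    have h1 := distC1_triangle g (γ x) (γ y) (γ c)
    have h2 := distC1_triangle g (γ y) (γ x) (γ c)
    rw [distC1_comm g (γ y) (γ x)] at h2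
    rw [dist_comm (ψ (γ x)), dist_eq_norm (ψ (γ y)), Real.dist_eq, abs_le]
    constructor <;> linarith

theorem exists_partition_isAdaptedChart (g : RMetric n M) {γ : ℝ → M} {a b C : ℝ} (hab : a ≤ b)
    (hC : 1 < C) (hγ : ContinuousOn γ (Icc a b)) :
    ∃ (t : ℕ → ℝ) (m : ℕ), Monotone t ∧ t 0 = a ∧ t m = b ∧ (∀ i, t i ∈ Icc a b) ∧
      ∀ i, ∃ ψ, IsAdaptedChart g C ψ ∧ MapsTo γ (Icc (t i) (t (i + 1))) ψ.source := by
  obtain ⟨t, m, hmono, h0, hm, hmem, ht⟩ := exists_partition_mapsTo hab hγ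
    (Q := fun U => ∃ ψ, IsAdaptedChart g C ψ ∧ U = ψ.source) fun p => by
      obtain ⟨ψ, hψ, hp, -⟩ := exists_isAdaptedChart g p hC univ_mem
      exact ⟨_, ψ.open_source, hp, ψ, hψ, rfl⟩
  refine ⟨t, m, hmono, h0, hm, hmem, fun i => ?_⟩
  obtain ⟨_, ⟨ψ, hψ, rfl⟩, h⟩ := ht i
  exact ⟨ψ, hψ, h⟩

theorem AbsCont.integrableOn_speed_and_distC1_le [T2Space M] [ConnectedSpace M] (g : RMetric n M)
    {γ : ℝ → M} {a b c e : ℝ} (hab : a < b) (hγ : AbsCont n γ a b) (hce : c ≤ e)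
    (hsub : Icc c e ⊆ Icc a b) :
    IntegrableOn (speed g γ a b) (Icc c e) ∧
      distC1 g (γ c) (γ e) ≤ ∫ t in c..e, speed g γ a b t := by
  -- Any constant above `1` would do: the bound by the integral of the speed holds on each piece
  -- without loss.
  obtain ⟨t, m, hmono, rfl, rfl, hmem, ht⟩ :=
    exists_partition_isAdaptedChart g hce one_lt_two (hγ.1.mono hsub)
  have key : ∀ i, IntegrableOn (speed g γ a b) (Icc (t 0) (t i)) ∧
      distC1 g (γ (t 0)) (γ (t i)) ≤ ∫ s in t 0..t i, speed g γ a b s := by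
    intro i
    induction i with
    | zero => simp [distC1_self]
    | succ i ih =>
      obtain ⟨ψ, hψ, hmaps⟩ := ht i
      have hs : Icc (t i) (t (i + 1)) ⊆ Icc a b :=
        (Icc_subset_Icc (hmem _).1 (hmem _).2).trans hsub
      have h1 := hγ.integrableOn_speed_of_mapsTo hab zero_le_two (hmono i.le_succ) hs hψ hmaps
      have h2 := hγ.distC1_le_integral_of_mapsTo hab zero_le_two (hmono i.le_succ) hs hψ hmaps
      refine ⟨?_, ?_⟩
      · rw [← Icc_union_Icc_eq_Icc (hmono (Nat.zero_le i)) (hmono i.le_succ)]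
        exact ih.1.union h1
      · rw [← intervalIntegral.integral_add_adjacent_intervals
          ((intervalIntegrable_iff_integrableOn_Icc_of_le (hmono (Nat.zero_le i))).2 ih.1)
          ((intervalIntegrable_iff_integrableOn_Icc_of_le (hmono i.le_succ)).2 h1)]
        linarith [distC1_triangle g (γ (t 0)) (γ (t i)) (γ (t (i + 1))), ih.2]
  exact key m

end AbsolutelyContinuousPaths

/-! ### Piecewise smooth paths define the same distance as `C¹` paths. -/

section PiecewiseSmoothPaths

variable {n : ℕ} {M : Type*} [TopologicalSpace M]
  [ChartedSpace (EuclideanSpace ℝ (Fin n)) M]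

theorem piecewiseSmooth_self (γ : ℝ → M) (a : ℝ) : PiecewiseSmooth n γ a a :=
  ⟨by simp, 0, _, isPartition_self a, fun i => i.elim0⟩

theorem PiecewiseSmooth.append {σ ρ : ℝ → M} {a b c : ℝ} (hσ : PiecewiseSmooth n σ a b)
    (hab : a ≤ b) (hbc : b < c) (hρ : ContMDiffOn 𝓘(ℝ, ℝ) (𝓡 n) ∞ ρ (Icc b c)) (h : ρ b = σ b) :
    PiecewiseSmooth n (fun t => if t ≤ b then σ t else ρ t) a c := by
  have h1 : EqOn (fun t => if t ≤ b then σ t else ρ t) σ (Icc a b) := fun t ht => if_pos ht.2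
  have h2 : EqOn (fun t => if t ≤ b then σ t else ρ t) ρ (Icc b c) := fun t ht => by
    rcases ht.1.eq_or_lt with rfl | hlt
    · simp [h]
    · simp [not_le.2 hlt]
  obtain ⟨hc, k, τ, hτ, hs⟩ := hσ
  refine ⟨?_, k + 1, _, hτ.snoc hbc, fun i => ?_⟩
  · rw [← Icc_union_Icc_eq_Icc hab hbc.le]
    exact (hc.congr h1).union_of_isClosed (hρ.continuousOn.congr h2) isClosed_Icc isClosed_Icc
  · refine Fin.lastCases ?_ (fun j => ?_) i
    · rw [Fin.succ_last, Fin.snoc_last, Fin.snoc_castSucc, hτ.right]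
      exact hρ.congr h2
    · rw [Fin.succ_castSucc, Fin.snoc_castSucc, Fin.snoc_castSucc]
      exact (hs j).congr fun t ht =>
        h1 ⟨(hτ.mem_Icc _).1.trans ht.1, ht.2.trans (hτ.mem_Icc _).2⟩

variable [IsManifold (𝓡 n) ∞ M]

/-- At the end points of the smaller interval the derivative becomes one-sided, and the speeds may
differ there. -/
theorem speed_eq_of_mem_Ioo (g : RMetric n M) (γ : ℝ → M) {a b c e t : ℝ}
    (hsub : Icc c e ⊆ Icc a b) (ht : t ∈ Ioo c e) : speed g γ c e t = speed g γ a b t := by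
  have h1 : Icc c e ∈ 𝓝 t := Icc_mem_nhds ht.1 ht.2
  have h2 : Icc a b ∈ 𝓝 t := mem_of_superset h1 hsub
  rw [speed, speed, velocity, velocity, mfderivWithin_of_mem_nhds h1, mfderivWithin_of_mem_nhds h2]

theorem arcLength_nonneg (g : RMetric n M) (γ : ℝ → M) (a b : ℝ) : 0 ≤ arcLength g γ a b :=
  integral_nonneg fun t => speed_nonneg g γ a b t

theorem arcLength_eq_intervalIntegral (g : RMetric n M) (γ : ℝ → M) {a b : ℝ} (hab : a ≤ b) :
    arcLength g γ a b = ∫ t in a..b, speed g γ a b t := by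
  rw [arcLength, integral_Icc_eq_integral_Ioc, intervalIntegral.integral_of_le hab]

/-- Integrability is essential here: a non-integrable speed would have `arcLength` equal to the
default value `0`, and such a path could spoil the infimum in `riemDist`. -/
theorem PiecewiseSmooth.integrableOn_speed_and_distC1_le [T2Space M] [ConnectedSpace M]
    (g : RMetric n M) {σ : ℝ → M} {a b : ℝ} (hσ : PiecewiseSmooth n σ a b) :
    IntegrableOn (speed g σ a b) (Icc a b) ∧ distC1 g (σ a) (σ b) ≤ arcLength g σ a b := by
  obtain ⟨-, k, τ, hτ, hs⟩ := hσ
  have hab : a ≤ b := (hτ.mem_Icc 0).1.trans (hτ.mem_Icc 0).2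
  have key : ∀ i, IntegrableOn (speed g σ a b) (Icc a (τ i)) ∧
      distC1 g (σ a) (σ (τ i)) ≤ ∫ s in a..τ i, speed g σ a b s := by
    intro i
    induction i using Fin.induction with
    | zero => simp [hτ.left, distC1_self]
    | succ i ih =>
      have hlt : τ i.castSucc < τ i.succ := hτ.strictMono Fin.castSucc_lt_succ
      have hsub : Icc (τ i.castSucc) (τ i.succ) ⊆ Icc a b :=
        Icc_subset_Icc (hτ.mem_Icc _).1 (hτ.mem_Icc _).2
      have heq : EqOn (speed g σ (τ i.castSucc) (τ i.succ)) (speed g σ a b)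
        (Ioo (τ i.castSucc) (τ i.succ)) := fun t ht => speed_eq_of_mem_Ioo g σ hsub ht
      obtain ⟨h1, h2⟩ := (ContMDiffOn.absCont (by simp) (hs i)).integrableOn_speed_and_distC1_le g
        hlt hlt.le le_rfl
      rw [integrableOn_Icc_iff_integrableOn_Ioo, integrableOn_congr_fun heq measurableSet_Ioo,
        ← integrableOn_Icc_iff_integrableOn_Ioo] at h1
      rw [intervalIntegral.integral_of_le hlt.le, integral_Ioc_eq_integral_Ioo,
        setIntegral_congr_fun measurableSet_Ioo heq, ← integral_Ioc_eq_integral_Ioo,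
        ← intervalIntegral.integral_of_le hlt.le] at h2
      refine ⟨?_, ?_⟩
      · rw [← Icc_union_Icc_eq_Icc (hτ.mem_Icc _).1 hlt.le]
        exact ih.1.union h1
      · rw [← intervalIntegral.integral_add_adjacent_intervals
          ((intervalIntegrable_iff_integrableOn_Icc_of_le (hτ.mem_Icc _).1).2 ih.1)
          ((intervalIntegrable_iff_integrableOn_Icc_of_le hlt.le).2 h1)]
        linarith [distC1_triangle g (σ a) (σ (τ i.castSucc)) (σ (τ i.succ)), ih.2]
  have := key (Fin.last k)
  rwa [hτ.right, ← arcLength_eq_intervalIntegral g σ hab] at this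

theorem PiecewiseSmooth.ofReal_arcLength [T2Space M] [ConnectedSpace M]
    (g : RMetric n M) {σ : ℝ → M} {a b : ℝ} (hσ : PiecewiseSmooth n σ a b) :
    ENNReal.ofReal (arcLength g σ a b) = lengthENN g σ a b :=
  ofReal_integral_eq_lintegral_ofReal (hσ.integrableOn_speed_and_distC1_le g).1
    (Eventually.of_forall fun t => speed_nonneg g σ a b t)

/-- The new path joins consecutive nodes by chart segments. One factor `C` comes from passing to
Euclidean lengths and one from passing back. -/
theorem exists_piecewiseSmooth_lengthENN_le (g : RMetric n M) {γ : ℝ → M} {a b C : ℝ}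
    (hab : a ≤ b) (hC : 1 < C) (hγ : ContMDiffOn 𝓘(ℝ, ℝ) (𝓡 n) 1 γ (Icc a b)) :
    ∃ ρ : ℝ → M, PiecewiseSmooth n ρ a b ∧ ρ a = γ a ∧ ρ b = γ b ∧
      lengthENN g ρ a b ≤ ENNReal.ofReal (C ^ 2) * lengthENN g γ a b := by
  have hC0 : 0 ≤ C := by linarith
  obtain ⟨t, m, hmono, rfl, rfl, hmem, ht⟩ :=
    exists_partition_isAdaptedChart g hab hC hγ.continuousOn
  have key : ∀ i, ∃ ρ : ℝ → M, PiecewiseSmooth n ρ (t 0) (t i) ∧ ρ (t 0) = γ (t 0) ∧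
      ρ (t i) = γ (t i) ∧
      lengthENN g ρ (t 0) (t i) ≤ ENNReal.ofReal (C ^ 2) * lengthENN g γ (t 0) (t i) := by
    intro i
    induction i with
    | zero => exact ⟨γ, piecewiseSmooth_self γ _, rfl, rfl, by simp [lengthENN_self]⟩
    | succ i ih =>
      have h0i : t 0 ≤ t i := hmono (Nat.zero_le i)
      -- Repeated nodes are skipped, since `IsPartition` demands strict monotonicity.
      rcases (hmono i.le_succ).eq_or_lt with heq | hlt
      · rwa [← Nat.succ_eq_add_one, ← heq]
      obtain ⟨σ, hσ, hσ0, hσi, hσl⟩ := ih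
      obtain ⟨ψ, hψ, hmaps⟩ := ht i
      obtain ⟨ρ, hρi, hρi1, hρ, hρl⟩ := hψ.exists_segment hC0 (hmaps ⟨le_rfl, hlt.le⟩)
        (hmaps ⟨hlt.le, le_rfl⟩) hlt
      refine ⟨_, hσ.append h0i hlt hρ (hρi.trans hσi.symm), by simp [h0i, hσ0],
        by simp [not_le.2 hlt, hρi1], ?_⟩
      rw [← lengthENN_add g _ h0i hlt.le, ← lengthENN_add g γ h0i hlt.le, mul_add]
      refine add_le_add ?_ ?_
      · rwa [lengthENN_congr g (γ' := σ) fun s hs => if_pos hs.2]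
      · rw [lengthENN_congr g (γ' := ρ) fun s hs => ?_]
        · refine hρl.trans ?_
          rw [ENNReal.ofReal_mul hC0, ofReal_norm, sq, ENNReal.ofReal_mul hC0, mul_assoc]
          exact mul_le_mul_right (hψ.enorm_sub_le hC0 hlt.le
            (hγ.mono (Icc_subset_Icc (hmem _).1 (hmem _).2)) hmaps) _
        · rcases hs.1.eq_or_lt with rfl | h
          · simp [hρi, hσi]
          · simp [not_le.2 h]
  exact key m

theorem riemDist_eq_distC1 [T2Space M] [ConnectedSpace M] (g : RMetric n M) :
    riemDist g = distC1 g := by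
  ext x y
  -- `C - 1` also serves as the slack in choosing a nearly optimal path, so a single parameter tends
  -- to `1`.
  have hle : ∀ C : ℝ, 1 < C → ∃ r ∈ {r | ∃ σ : ℝ → M, PiecewiseSmooth n σ 0 1 ∧ σ 0 = x ∧ σ 1 = y ∧
      r = arcLength g σ 0 1}, r ≤ C ^ 2 * (distC1 g x y + (C - 1)) := fun C hC => by
    have hlt : edistC1 g x y < ENNReal.ofReal (distC1 g x y + (C - 1)) := by
      rw [ENNReal.lt_ofReal_iff_toReal_lt (edistC1_lt_top g x y).ne]
      exact lt_add_of_pos_right _ (sub_pos.2 hC)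
    obtain ⟨γ, rfl, rfl, hγ, hl⟩ := exists_lengthENN_lt g hlt
    obtain ⟨ρ, hρ, h0, h1, hρl⟩ := exists_piecewiseSmooth_lengthENN_le g zero_le_one hC hγ
    refine ⟨_, ⟨ρ, hρ, h0, h1, rfl⟩, ?_⟩
    have hnn : 0 ≤ distC1 g (γ 0) (γ 1) + (C - 1) :=
      add_nonneg (distC1_nonneg g _ _) (sub_pos.2 hC).le
    rw [← ENNReal.ofReal_le_ofReal_iff (by positivity), hρ.ofReal_arcLength,
      ENNReal.ofReal_mul (by positivity)]
    exact hρl.trans (mul_le_mul_right hl.le _)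
  refine le_antisymm ?_ (le_csInf ?_ ?_)
  · have hlim : Tendsto (fun C : ℝ => C ^ 2 * (distC1 g x y + (C - 1))) (𝓝[>] 1)
        (𝓝 (distC1 g x y)) := by
      have : Tendsto (fun C : ℝ => C ^ 2 * (distC1 g x y + (C - 1))) (𝓝 1)
          (𝓝 ((1 : ℝ) ^ 2 * (distC1 g x y + (1 - 1)))) :=
        (by fun_prop : Continuous fun C : ℝ => C ^ 2 * (distC1 g x y + (C - 1))).tendsto 1
      simpa using this.mono_left nhdsWithin_le_nhds
    refine ge_of_tendsto hlim ?_
    filter_upwards [self_mem_nhdsWithin] with C hC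
    obtain ⟨r, hr, hrC⟩ := hle C hC
    refine (csInf_le ⟨0, ?_⟩ hr).trans hrC
    rintro _ ⟨σ, -, -, -, rfl⟩
    exact arcLength_nonneg g σ 0 1
  · obtain ⟨r, hr, -⟩ := hle 2 one_lt_two
    exact ⟨r, hr⟩
  · rintro _ ⟨σ, hσ, rfl, rfl, rfl⟩
    exact (hσ.integrableOn_speed_and_distC1_le g).2

end PiecewiseSmoothPaths

end ContRiem

/-! ### Equality of the three lengths. -/

theorem mainTheorem1 {n : ℕ} {M : Type*} [TopologicalSpace M] [T2Space M] [ConnectedSpace M]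
    [ChartedSpace (EuclideanSpace ℝ (Fin n)) M] [IsManifold (𝓡 n) ∞ M]
    (g : ContRiem.RMetric n M) {a b : ℝ} (hab : a < b) (γ : ℝ → M)
    (hγ : ContRiem.AbsCont n γ a b) :
    -- the derivative exists almost everywhere and the speed is integrable
    (∀ᵐ t ∂(volume.restrict (Icc a b)), ContRiem.DifferentiableAtTime n γ a b t) ∧
    IntegrableOn (fun t => ContRiem.speed g γ a b t) (Icc a b) ∧
    -- the metric derivative exists almost everywhere and is integrable
    (∀ᵐ t ∂(volume.restrict (Icc a b)),
      ∃ l : ℝ, ContRiem.HasMetricDeriv (ContRiem.riemDist g) γ a b t l) ∧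
    IntegrableOn (fun t => ContRiem.metricDeriv (ContRiem.riemDist g) γ a b t) (Icc a b) ∧
    -- the path is rectifiable
    BddAbove (ContRiem.polygonalSums (ContRiem.riemDist g) γ a b) ∧
    -- the three lengths agree
    ContRiem.arcLength g γ a b = ContRiem.inducedLength (ContRiem.riemDist g) γ a b ∧
    ContRiem.inducedLength (ContRiem.riemDist g) γ a b =
      ContRiem.metricArcLength (ContRiem.riemDist g) γ a b := by
  have hdiff := hγ.ae_differentiableAtTime hab.le
  have hint := fun {c e : ℝ} => hγ.integrableOn_speed_and_distC1_le (c := c) (e := e) g hab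
  have hsp : IntegrableOn (ContRiem.speed g γ a b) (Icc a b) := (hint hab.le subset_rfl).1
  have hmd : ∀ᵐ t ∂(volume.restrict (Icc a b)),
      ContRiem.HasMetricDeriv (ContRiem.riemDist g) γ a b t (ContRiem.speed g γ a b t) := by
    filter_upwards [hdiff] with t ht
    rw [ContRiem.riemDist_eq_distC1]
    exact ht.hasMetricDeriv g
  have hmeq : ContRiem.speed g γ a b =ᵐ[volume.restrict (Icc a b)]
      ContRiem.metricDeriv (ContRiem.riemDist g) γ a b := by
    filter_upwards [hmd, ae_restrict_mem measurableSet_Icc] with t ht htab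
    exact (ht.metricDeriv_eq hab htab).symm
  obtain ⟨hbdd, hlen⟩ := ContRiem.inducedLength_eq_integral (d := ContRiem.riemDist g) (γ := γ) hab
    (fun x y => by rw [ContRiem.riemDist_eq_distC1]; exact ContRiem.distC1_nonneg g x y)
    (fun x y => by rw [ContRiem.riemDist_eq_distC1]; exact ContRiem.distC1_comm g x y) hsp
    (fun s t has hst htb => by
      rw [ContRiem.riemDist_eq_distC1]
      exact (hint hst (Icc_subset_Icc has htb)).2) hmd
  have harc := ContRiem.arcLength_eq_intervalIntegral g γ hab.le
  refine ⟨hdiff, hsp, hmd.mono fun t ht => ⟨_, ht⟩, hsp.congr_fun_ae hmeq, hbdd,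
    harc.trans hlen.symm, ?_⟩
  rw [hlen, ← harc]
  exact integral_congr_ae hmeq
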